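/- Let $i\ge 1$, $0\le m\le \ell<k$ and $d=2k-2+i\le n-1$ be integers, let $\mathbb F_q$ be a finite field, and put $\alpha=k-1+i$, $n'=n+i$. **Encoding matrix.** Let $\Phi$ be an $n'\times\alpha$ matrix over $\mathbb F_q$, $\Lambda=\mathrm{diag}(\lambda_1,\dots,\lambda_{n'})$ and $\Psi'=[\Phi\ \ \Lambda\Phi]$, such that (i) any $\alpha$ rows of $\Phi$ are linearly independent, (ii) any $2\alpha$ rows of $\Psi'$ are linearly independent, (iii) the $\lambda_j$ are distinct, and (iv) for each $c\in\{m,\,i-1,\,i,\,\ell+i-1,\,\ell+i\}$, any $c$ rows of $\Psi'$ restricted to its first $c$ columns are linearly independent. **Code.** Consider message matrices $M=\begin{bmatrix}S_1\\S_2\end{bmatrix}$ with symmetric $\alpha\times\alpha$ blocks $S_1,S_2$ over $\mathbb F_q$. In the $[n+i,k+i,d+i]$ product-matrix code of security level $\{\ell+i,m\}$, the random symbols are the entries in the first $\ell+i$ rows and columns of $S_1$, in the top-left $(\ell+i-1)\times(\ell+i-1)$ part of $S_2$, and in the first $m$ rows and columns of $S_2$; all other entries are message symbols. For the shortened code, the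 random symbols in the first $i$ rows and columns of $S_1$ and in the top-left $(i-1)\times(i-1)$ part of $S_2$ are not drawn at random but chosen, as functions of all other symbols, so that the first $i$ rows of $\Psi'M$ vanish. The remaining random symbols are independent, uniform on $\mathbb F_q$, and independent of the message, which has an arbitrary distribution. Node $j\in\{1,\dots,n\}$ stores row $i+j$ of $\Psi'M$ ($\alpha$ symbols). To repair node $f$, each of $d$ other nodes passes the inner product of its stored row with $\phi_f$, the row $i+f$ of $\Phi$. **Claim.** 1. The number of message symbols is $B^*=(k-\ell)(k-1+i-m)$. The symbols that are chosen deterministically are $i\alpha$ of the random symbols of the longer code, and $R^*=\ell\alpha+(k-\ell)m$ random symbols remain, so that $B^*+R^*=k\alpha$. 2. For all values of the message symbols and of the remaining random symbols, the deterministic choice exists and is unique. 3. The shortened code is an $[n,k,d]$ MSR code with $\beta=1$: the message can be recovered from the contents of any $k$ nodes, and the content of any node from the symbols passed by any $d$ other nodes. 4. The shortened code is $\{\ell,m\}$-secure: for every set $A$ of at most $\ell$ nodes and every $B\subseteq A$ of at most $m$ nodes, the contents of the nodes in $A$ together with all data passed during any repair operations of nodes in $B$ have zero mutual information with the message. 5.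 If $x_1,\dots,x_{n'}\in\mathbb F_q$ have distinct powers $x_j^\alpha$, then the Vandermonde choice with rows $(1,x_j,\dots,x_j^{2\alpha-1})$ of $\Psi'$ satisfies (i)–(iv). -/

import Mathlib

open MeasureTheory

namespace SecureMSR

/-- Positions of the free symbols of a message matrix `[S₁; S₂]` with symmetric `α × α` blocks:
`(0, s(a, b))` is the entry `(a, b)` (and `(b, a)`) of `S₁`, and `(1, s(a, b))` that of `S₂`.
Indices are 0-based. -/
abbrev Pos (α : ℕ) : Type := Fin 2 × Sym2 (Fin α)

section Code

variable {F : Type*} [Field F] {N α : ℕ}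

/-- The symmetric block `S₁` (for `t = 0`) or `S₂` (for `t = 1`). -/
def block (v : Pos α → F) (t : Fin 2) : Matrix (Fin α) (Fin α) F :=
  Matrix.of fun a b => v (t, s(a, b))

/-- The `2α × α` message matrix `M = [S₁; S₂]`. -/
def messageMatrix (v : Pos α → F) : Matrix (Fin α ⊕ Fin α) (Fin α) F :=
  Matrix.fromRows (block v 0) (block v 1)

/-- The `N × 2α` encoding matrix `Ψ = [Φ  ΛΦ]`, where `Λ = diag(lam)`. -/
def encodingMatrix (Φ : Matrix (Fin N) (Fin α) F) (lam : Fin N → F) :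
    Matrix (Fin N) (Fin α ⊕ Fin α) F :=
  Matrix.fromCols Φ (Matrix.diagonal lam * Φ)

/-- The code matrix `C = ΨM`; row `j` is the content of node `j`. -/
def codeMatrix (Φ : Matrix (Fin N) (Fin α) F) (lam : Fin N → F) (v : Pos α → F) :
    Matrix (Fin N) (Fin α) F :=
  encodingMatrix Φ lam * messageMatrix v

/-- The single symbol that helper node `j` passes for the repair of node `f`: the inner product
of the content of node `j` with the row `φ_f` of `Φ`. -/
def repairSymbol (Φ C : Matrix (Fin N) (Fin α) F) (f j : Fin N) : F :=
  C j ⬝ᵥ Φ f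

/-- Any `t` rows of `A` are linearly independent. -/
def AnyRowsIndep {m n : Type*} (A : Matrix m n F) (t : ℕ) : Prop :=
  ∀ s : Finset m, s.card = t → LinearIndependent F (fun r : s => A r)

/-- The restriction of `Φ` to its first `c` columns. -/
def firstCols (Φ : Matrix (Fin N) (Fin α) F) (c : ℕ) :
    Matrix (Fin N) {a : Fin α // (a : ℕ) < c} F :=
  Φ.submatrix id Subtype.val

/-- The requirements on the encoding matrix `Ψ' = [Φ  ΛΦ]` of the longer code, for the shortening
parameter `i` and the security level `{ℓ, m}` of the shortened code. -/
structure IsAdmissible (i ℓ m : ℕ) (Φ : Matrix (Fin N) (Fin α) F) (lam : Fin N → F) : Prop where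
  phi_indep : AnyRowsIndep Φ α
  psi_indep : AnyRowsIndep (encodingMatrix Φ lam) (2 * α)
  lam_injective : Function.Injective lam
  leading_indep : ∀ c ∈ ({m, i - 1, i, ℓ + i - 1, ℓ + i} : Set ℕ), AnyRowsIndep (firstCols Φ c) c

/-- The left half of the Vandermonde matrix with rows `(1, x_r, …, x_r ^ (2α - 1))`. -/
def vandermondePhi (α : ℕ) (x : Fin N → F) : Matrix (Fin N) (Fin α) F :=
  Matrix.of fun r c => x r ^ (c : ℕ)

end Code

section Positions

variable {α : ℕ}

/-- Positions filled by random symbols in the code of security level `{ℓ, m}`: the first `ℓ` rows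
and columns of `S₁`, the top-left `(ℓ-1) × (ℓ-1)` part of `S₂`, and the first `m` rows and columns
of `S₂`. -/
def IsRandomPos (ℓ m : ℕ) (p : Pos α) : Prop :=
  (p.1 = 0 ∧ ∃ a ∈ p.2, (a : ℕ) < ℓ) ∨
  (p.1 = 1 ∧ ((∀ a ∈ p.2, (a : ℕ) + 1 < ℓ) ∨ ∃ a ∈ p.2, (a : ℕ) < m))

/-- Positions whose symbols are chosen deterministically in the shortening by `i` nodes: the first
`i` rows and columns of `S₁` and the top-left `(i-1) × (i-1)` part of `S₂`. -/
def IsForcedPos (i : ℕ) (p : Pos α) : Prop :=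
  (p.1 = 0 ∧ ∃ a ∈ p.2, (a : ℕ) < i) ∨ (p.1 = 1 ∧ ∀ a ∈ p.2, (a : ℕ) + 1 < i)

/-- Message positions: the non-random positions of the code of level `{ℓ + i, m}`. -/
abbrev MsgPos (α i ℓ m : ℕ) : Type := {p : Pos α // ¬ IsRandomPos (ℓ + i) m p}

/-- Positions that stay random after the shortening. -/
abbrev RandPos (α i ℓ m : ℕ) : Type := {p : Pos α // IsRandomPos (ℓ + i) m p ∧ ¬ IsForcedPos i p}

/-- `v` is a filling of the message matrix that carries the message symbols `u` and the random
symbols `r`, and for which the first `i` of the `i + n` nodes store zero. -/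
structure IsShortenedFilling {F : Type*} [Field F] {n i ℓ m : ℕ}
    (Φ : Matrix (Fin (i + n)) (Fin α) F) (lam : Fin (i + n) → F)
    (u : MsgPos α i ℓ m → F) (r : RandPos α i ℓ m → F) (v : Pos α → F) : Prop where
  message : ∀ p : MsgPos α i ℓ m, v p = u p
  random : ∀ p : RandPos α i ℓ m, v p = r p
  zero : ∀ j : Fin i, codeMatrix Φ lam v (Fin.castAdd n j) = 0

/-- The encoding rows of the last `n` nodes, which are the nodes of the shortened code. -/
def lastRows {F : Type*} {n i : ℕ} (Φ : Matrix (Fin (i + n)) (Fin α) F) :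
    Matrix (Fin n) (Fin α) F :=
  Φ.submatrix (Fin.natAdd i) id

/-- The code matrix `C* = Ψ* M*` of the shortened code: `Ψ*` consists of the last `n` rows of
`Ψ' = [Φ  ΛΦ]`, and `M*` is the message matrix with entries `v`. -/
def shortenedCodeMatrix {F : Type*} [Field F] {n i : ℕ}
    (Φ : Matrix (Fin (i + n)) (Fin α) F) (lam : Fin (i + n) → F) (v : Pos α → F) :
    Matrix (Fin n) (Fin α) F :=
  codeMatrix (lastRows Φ) (fun j => lam (Fin.natAdd i j)) v

end Positions

section Model

variable {F : Type*} [Field F] {n α : ℕ} {P Q : Type*}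

/-- Data reconstruction: the message can be recovered from the contents of any `k` nodes.
Here `C u r` is the code matrix for the message `u` and the random symbols `r`. -/
def Reconstructs (k : ℕ) (C : (P → F) → (Q → F) → Matrix (Fin n) (Fin α) F) : Prop :=
  ∀ K : Finset (Fin n), K.card = k →
    ∃ dec : (K → Fin α → F) → (P → F), ∀ u r, dec (fun j => C u r j) = u

/-- Node repair: the content of any node can be recovered from one symbol from each of any `d`
other nodes. -/
def Repairs (d : ℕ) (Φ : Matrix (Fin n) (Fin α) F)
    (C : (P → F) → (Q → F) → Matrix (Fin n) (Fin α) F) : Prop :=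
  ∀ (f : Fin n) (H : Finset (Fin n)), f ∉ H → H.card = d →
    ∃ rec : (H → F) → (Fin α → F), ∀ u r, rec (fun h => repairSymbol Φ (C u r) f h) = C u r f

/-- What an eavesdropper sees who reads the contents of the nodes in `A` and all the symbols passed
in the repair operations in `T`; the pair `(f, H)` is the repair of node `f` by the helpers `H`. -/
def view (Φ : Matrix (Fin n) (Fin α) F) (A : Finset (Fin n))
    (T : Finset (Fin n × Finset (Fin n))) (C : Matrix (Fin n) (Fin α) F) :
    (A → Fin α → F) × ((t : T) → t.1.2 → F) :=
  (fun a => C a, fun t h => repairSymbol Φ C t.1.1 h)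

/-- Mutual information `I(X; Y)` (in nats): the Kullback–Leibler divergence of the joint law from
the product of the marginal laws. -/
noncomputable def mutualInfo {Ω X Y : Type*} [MeasurableSpace Ω] [MeasurableSpace X]
    [MeasurableSpace Y] (μ : Measure Ω) (f : Ω → X) (g : Ω → Y) : ENNReal :=
  InformationTheory.klDiv (μ.map fun ω => (f ω, g ω)) ((μ.map f).prod (μ.map g))

/-- `{ℓ, m}`-security from the passive eavesdropper: for every law `ν` of the message, with the
random symbols uniform and independent of the message, an eavesdropper who reads the contents of a
set `A` of at most `ℓ` nodes and all the data passed in any repair operations (each with `d`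
helpers) of nodes in a set `B ⊆ A` of at most `m` nodes has zero mutual information with the
message. -/
def IsSecure [MeasurableSpace F] (ℓ m d : ℕ) (Φ : Matrix (Fin n) (Fin α) F)
    (C : (P → F) → (Q → F) → Matrix (Fin n) (Fin α) F) : Prop :=
  ∀ (A B : Finset (Fin n)) (T : Finset (Fin n × Finset (Fin n))),
    A.card ≤ ℓ → B ⊆ A → B.card ≤ m →
    (∀ t ∈ T, t.1 ∈ B ∧ t.1 ∉ t.2 ∧ t.2.card = d) →
    ∀ ν : Measure (P → F), IsProbabilityMeasure ν →
      mutualInfo (ν.prod (ProbabilityTheory.uniformOn (Set.univ : Set (Q → F))))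
        (fun ω => ω.1) (fun ω => view Φ A T (C ω.1 ω.2)) = 0

end Model

end SecureMSR

open SecureMSR

/-! Everything rests on the symmetry of the blocks. If distinct nodes `a`, `b` store zero, then `φ_a
S₁ φ_b + λ φ_a S₂ φ_b = 0` for both `λ = λ_a` and `λ = λ_b`, so both products vanish
(`blockRow_dotProduct_eq_zero`).

The core is a square linear system for the level `{c, m}`. Prescribe the contents of `c` nodes, the
products `φ_f S₂ φ_e` for `m` of these nodes and `α + 1 - c` outside rows, and the non-random
symbols. The kernel is trivial (`eq_zero_of_supported`), and the number of equations is `cα +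
m(α+1-c) + (α-m)(α+1-c) = α(α+1)`, the number of unknowns; hence the system is solvable
(`exists_filling`).

It is used twice. Level `{i, 0}` gives existence and uniqueness of the shortening. Level `{ℓ+i, m}`,
with the removed nodes counted among the `c`, gives for each message random symbols that make the
eavesdropper's view zero. By linearity, changing the message then only translates the uniform random
symbols, so the law of the view is the same for all messages.

The removed nodes act as known zeros: `k` nodes become `α + 1` for decoding, and `d` helpers become
`2α` for repair. -/

namespace SecureMSR

/-! ### Vanishing criteria for symmetric blocks -/

section LinearAlgebra

variable {F : Type*} [Field F] {N α : ℕ}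

/-- A vector orthogonal to as many independent rows as there are columns vanishes. -/
lemma AnyRowsIndep.eq_zero_of_dotProduct {r c : Type*} [Fintype c] {A : Matrix r c F} {t : ℕ}
    (hA : AnyRowsIndep A t) (ht : Fintype.card c = t) {s : Finset r} (hs : s.card = t)
    {w : c → F} (hw : ∀ a ∈ s, A a ⬝ᵥ w = 0) : w = 0 := by
  classical
  have hspan := (hA s hs).span_eq_top_of_card_eq_finrank' (by simp [hs, ht])
  have hker : (⊤ : Submodule F (c → F)) ≤ LinearMap.ker ((dotProductBilin F F).flip w) := by
    rw [← hspan, Submodule.span_le]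
    rintro _ ⟨a, rfl⟩
    exact hw a a.2
  refine funext fun j => ?_
  have := hker (x := Pi.single j 1) trivial
  simpa using this

lemma card_fin_lt {c : ℕ} (hc : c ≤ α) : Fintype.card {a : Fin α // (a : ℕ) < c} = c := by
  rw [Fintype.card_subtype, Fin.card_filter_val_lt, min_eq_right hc]

lemma AnyRowsIndep.eq_zero_of_firstCols {Φ : Matrix (Fin N) (Fin α) F} {c : ℕ} (hc : c ≤ α)
    (h : AnyRowsIndep (firstCols Φ c) c) {s : Finset (Fin N)} (hs : s.card = c) {w : Fin α → F}
    (hsupp : ∀ a : Fin α, c ≤ a → w a = 0) (hw : ∀ a ∈ s, Φ a ⬝ᵥ w = 0) : w = 0 := by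
  have key : (fun a : {a : Fin α // (a : ℕ) < c} => w a) = 0 := by
    refine h.eq_zero_of_dotProduct (card_fin_lt hc) hs fun a ha => ?_
    rw [← hw a ha]
    have hsum : ∑ x ∈ Finset.univ.filter (fun x : Fin α => (x : ℕ) < c), Φ a x * w x =
        ∑ x : {x : Fin α // (x : ℕ) < c}, Φ a x * w x :=
      Finset.sum_subtype _ (by simp) _
    refine hsum.symm.trans (Finset.sum_subset (Finset.filter_subset _ _) fun x _ hx => ?_)
    rw [hsupp x (by simpa using hx), mul_zero]
  funext a
  by_cases ha : (a : ℕ) < c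
  · exact congrFun key ⟨a, ha⟩
  · exact hsupp a (not_lt.1 ha)

/-- The row `φ_a S_t`. -/
def blockRow (Φ : Matrix (Fin N) (Fin α) F) (v : Pos α → F) (t : Fin 2) (a : Fin N) :
    Fin α → F :=
  Matrix.vecMul (Φ a) (block v t)

lemma blockRow_apply (Φ : Matrix (Fin N) (Fin α) F) (v : Pos α → F) (t : Fin 2) (a : Fin N)
    (j : Fin α) : blockRow Φ v t a j = Φ a ⬝ᵥ fun b => v (t, s(b, j)) := rfl

lemma blockRow_dotProduct_comm (Φ : Matrix (Fin N) (Fin α) F) (v : Pos α → F) (t : Fin 2)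
    (a b : Fin N) : blockRow Φ v t a ⬝ᵥ Φ b = blockRow Φ v t b ⬝ᵥ Φ a := by
  have hsymm : (block v t).transpose = block v t := by
    ext x y
    simp [block, Sym2.eq_swap]
  rw [blockRow, blockRow, ← Matrix.dotProduct_mulVec, dotProduct_comm, ← Matrix.vecMul_transpose,
    hsymm]

lemma codeMatrix_row (Φ : Matrix (Fin N) (Fin α) F) (lam : Fin N → F) (v : Pos α → F)
    (a : Fin N) :
    codeMatrix Φ lam v a = blockRow Φ v 0 a + lam a • blockRow Φ v 1 a := by
  ext j
  simp [codeMatrix, encodingMatrix, messageMatrix, Matrix.fromCols_mul_fromRows, blockRow,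
    Matrix.mul_assoc, Matrix.diagonal_mul]
  rfl

lemma blockRow_add (Φ : Matrix (Fin N) (Fin α) F) (v w : Pos α → F) (t : Fin 2) (a : Fin N) :
    blockRow Φ (v + w) t a = blockRow Φ v t a + blockRow Φ w t a :=
  Matrix.vecMul_add _ _ _

lemma blockRow_smul (Φ : Matrix (Fin N) (Fin α) F) (x : F) (v : Pos α → F) (t : Fin 2)
    (a : Fin N) : blockRow Φ (x • v) t a = x • blockRow Φ v t a :=
  Matrix.vecMul_smul _ _ _

lemma codeMatrix_row_sub (Φ : Matrix (Fin N) (Fin α) F) (lam : Fin N → F) (v w : Pos α → F)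
    (a : Fin N) :
    codeMatrix Φ lam (v - w) a = codeMatrix Φ lam v a - codeMatrix Φ lam w a := by
  have h := fun t => blockRow_add Φ (v - w) w t a
  simp only [sub_add_cancel] at h
  simp only [codeMatrix_row, h, smul_add]
  abel

/-- Two nodes that store zero are orthogonal with respect to both blocks. -/
lemma blockRow_dotProduct_eq_zero {Φ : Matrix (Fin N) (Fin α) F} {lam : Fin N → F}
    {v : Pos α → F} (hlam : Function.Injective lam) {a b : Fin N} (hab : a ≠ b)
    (ha : codeMatrix Φ lam v a = 0) (hb : codeMatrix Φ lam v b = 0) (t : Fin 2) :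
    blockRow Φ v t a ⬝ᵥ Φ b = 0 := by
  rw [codeMatrix_row] at ha hb
  have h1 := congrArg (· ⬝ᵥ Φ b) ha
  have h2 := congrArg (· ⬝ᵥ Φ a) hb
  simp only [add_dotProduct, smul_dotProduct, zero_dotProduct, smul_eq_mul] at h1 h2
  rw [blockRow_dotProduct_comm Φ v 0 b a, blockRow_dotProduct_comm Φ v 1 b a] at h2
  have hne : lam a - lam b ≠ 0 := sub_ne_zero.2 (hlam.ne hab)
  have h3 : blockRow Φ v 1 a ⬝ᵥ Φ b = 0 := by
    have : (lam a - lam b) * (blockRow Φ v 1 a ⬝ᵥ Φ b) = 0 := by linear_combination h1 - h2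
    exact (mul_eq_zero.1 this).resolve_left hne
  fin_cases t
  · simpa [h3] using h1
  · exact h3

/-- A column supported on the first `c` positions vanishes if the blocks of `c` rows do. -/
lemma column_eq_zero {Φ : Matrix (Fin N) (Fin α) F} {c : ℕ} (hc : c ≤ α)
    (h : AnyRowsIndep (firstCols Φ c) c) {s : Finset (Fin N)} (hs : s.card = c)
    {v : Pos α → F} {t : Fin 2} {j : Fin α}
    (hsupp : ∀ a : Fin α, c ≤ a → v (t, s(a, j)) = 0) (hw : ∀ a ∈ s, blockRow Φ v t a = 0)
    (b : Fin α) : v (t, s(b, j)) = 0 :=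
  congrFun (h.eq_zero_of_firstCols hc hs (w := fun b => v (t, s(b, j))) hsupp fun a ha => by
    rw [← blockRow_apply, hw a ha, Pi.zero_apply]) b

/-- A block vanishes if it is orthogonal to all pairs of distinct rows out of `α + 1`. -/
lemma block_eq_zero {Φ : Matrix (Fin N) (Fin α) F} (h : AnyRowsIndep Φ α) {R : Finset (Fin N)}
    (hR : R.card = α + 1) {v : Pos α → F} {t : Fin 2}
    (horth : ∀ a ∈ R, ∀ b ∈ R, a ≠ b → blockRow Φ v t a ⬝ᵥ Φ b = 0) (z : Sym2 (Fin α)) :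
    v (t, z) = 0 := by
  have hrow : ∀ a ∈ R, blockRow Φ v t a = 0 := fun a ha =>
    h.eq_zero_of_dotProduct (by simp) (s := R.erase a) (by simp [ha, hR]) fun b hb => by
      rw [dotProduct_comm]
      exact horth a ha b (Finset.mem_of_mem_erase hb) (Finset.ne_of_mem_erase hb).symm
  obtain ⟨s, hsR, hs⟩ := Finset.exists_subset_card_eq (s := R) (n := α) (by omega)
  induction z with
  | _ b j =>
    exact congrFun (h.eq_zero_of_dotProduct (by simp) hs (w := fun b => v (t, s(b, j)))
      fun a ha => by rw [← blockRow_apply, hrow a (hsR ha), Pi.zero_apply]) b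

/-- The other rows of `R` are orthogonal to `φ_f S₂` automatically and those of `E` by assumption,
which makes `α` independent rows. Once `φ_f S₂ = 0`, the zero content of `f` forces `φ_f S₁ = 0`. -/
lemma blockRow_eq_zero_of_orthogonal {Φ : Matrix (Fin N) (Fin α) F} {lam : Fin N → F}
    {v : Pos α → F} (hΦ : AnyRowsIndep Φ α) (hlam : Function.Injective lam)
    {R E : Finset (Fin N)} (hE : Disjoint R E) (hcard : R.card + E.card = α + 1)
    (hzero : ∀ a ∈ R, codeMatrix Φ lam v a = 0) {f : Fin N} (hf : f ∈ R)
    (horth : ∀ e ∈ E, blockRow Φ v 1 f ⬝ᵥ Φ e = 0) (t : Fin 2) : blockRow Φ v t f = 0 := by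
  have h1 : blockRow Φ v 1 f = 0 := by
    refine hΦ.eq_zero_of_dotProduct (by simp) (s := R.erase f ∪ E) ?_ fun b hb => ?_
    · rw [Finset.card_union_of_disjoint (hE.mono_left (Finset.erase_subset _ _)),
        Finset.card_erase_of_mem hf]
      have := Finset.card_pos.2 ⟨f, hf⟩
      omega
    · rw [dotProduct_comm]
      rcases Finset.mem_union.1 hb with hb | hb
      · exact blockRow_dotProduct_eq_zero hlam (Finset.ne_of_mem_erase hb).symm (hzero f hf)
          (hzero b (Finset.mem_of_mem_erase hb)) 1
      · exact horth b hb
  have h0 := hzero f hf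
  rw [codeMatrix_row, h1] at h0
  fin_cases t
  · simpa using h0
  · exact h1

/-- The random symbols of level `{c, m}` are determined by `c` node contents and by the `S₂` parts
of `m` of these nodes. -/
lemma eq_zero_of_supported {Φ : Matrix (Fin N) (Fin α) F} {lam : Fin N → F} {c m : ℕ}
    (hmc : m < c) (hcα : c ≤ α) (hΦ : AnyRowsIndep Φ α) (hlam : Function.Injective lam)
    (hlead : ∀ x ∈ ({m, c - 1, c} : Set ℕ), AnyRowsIndep (firstCols Φ x) x)
    {R B E : Finset (Fin N)} (hR : R.card = c) (hBR : B ⊆ R) (hB : B.card = m)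
    (hE : Disjoint R E) (hEc : E.card = α + 1 - c) {v : Pos α → F}
    (hsupp : ∀ p, ¬ IsRandomPos c m p → v p = 0)
    (hzero : ∀ a ∈ R, codeMatrix Φ lam v a = 0)
    (horth : ∀ f ∈ B, ∀ e ∈ E, blockRow Φ v 1 f ⬝ᵥ Φ e = 0) : v = 0 := by
  have hB0 : ∀ f ∈ B, blockRow Φ v 1 f = 0 := fun f hf =>
    blockRow_eq_zero_of_orthogonal hΦ hlam hE (by omega) hzero (hBR hf) (horth f hf) 1
  -- Beyond the `(c-1) × (c-1)` corner, a column of `S₂` has random entries only in its first `m`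
  -- places, and the `m` rows of `B` kill these.
  have hS2supp : ∀ a j : Fin α, c - 1 ≤ j → v (1, s(a, j)) = 0 := fun a j hj =>
    column_eq_zero (by omega) (hlead m (by simp)) hB
      (fun a ha => hsupp _ (by simp [IsRandomPos]; omega)) hB0 a
  -- Now `φ_a S₂` lives on `c - 1` coordinates, so the `c - 1` other rows of `R` suffice.
  have hS2row : ∀ a ∈ R, blockRow Φ v 1 a = 0 := fun a ha => by
    refine (hlead (c - 1) (by simp)).eq_zero_of_firstCols (by omega) (s := R.erase a)
      (by simp [ha, hR]) (fun j hj => ?_) fun b hb => ?_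
    · simp [blockRow_apply, hS2supp _ j hj, dotProduct]
    · rw [dotProduct_comm]
      exact blockRow_dotProduct_eq_zero hlam (Finset.ne_of_mem_erase hb).symm (hzero a ha)
        (hzero b (Finset.mem_of_mem_erase hb)) 1
  have hS2 : ∀ a j : Fin α, v (1, s(a, j)) = 0 := fun a j => by
    obtain ⟨s, hsR, hs⟩ := Finset.exists_subset_card_eq (s := R) (n := c - 1) (by omega)
    refine column_eq_zero (by omega) (hlead (c - 1) (by simp)) hs (fun a ha => ?_)
      (fun a ha => hS2row a (hsR ha)) a
    rw [Sym2.eq_swap]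
    exact hS2supp j a ha
  have hS1row : ∀ a ∈ R, blockRow Φ v 0 a = 0 := fun a ha => by
    simpa [codeMatrix_row, hS2row a ha] using hzero a ha
  have hS1supp : ∀ a j : Fin α, c ≤ j → v (0, s(a, j)) = 0 := fun a j hj =>
    column_eq_zero hcα (hlead c (by simp)) hR
      (fun a ha => hsupp _ (by simp [IsRandomPos]; omega)) hS1row a
  -- By symmetry the vanishing columns are also vanishing rows, so every column is now supported on
  -- its first `c` places.
  have hS1 : ∀ a j : Fin α, v (0, s(a, j)) = 0 := fun a j => by
    refine column_eq_zero hcα (hlead c (by simp)) hR (fun a ha => ?_) hS1row a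
    rw [Sym2.eq_swap]
    exact hS1supp j a ha
  funext ⟨t, z⟩
  induction z with
  | _ a j =>
    fin_cases t
    · exact hS1 a j
    · exact hS2 a j

end LinearAlgebra

/-! ### Counting positions -/

section Counting

variable {α : ℕ}

/-- In `S₁` these are the unordered pairs from `[c, α)`; in `S₂` the pairs from `[m, α)` that do not
lie inside `[m, c-1)`. -/
lemma card_notRandom {c m : ℕ} (hmc : m < c) (hcα : c ≤ α) :
    Nat.card {p : Pos α // ¬ IsRandomPos c m p} = (α - m) * (α + 1 - c) := by
  classical
  have h0 : (Finset.univ.filter fun z : Sym2 (Fin α) => ¬ IsRandomPos c m ((0 : Fin 2), z))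
      = (Finset.univ.filter fun a : Fin α => c ≤ (a : ℕ)).sym2 := by
    ext z
    simp [IsRandomPos, Finset.mem_sym2_iff]
  have h1 : (Finset.univ.filter fun z : Sym2 (Fin α) => ¬ IsRandomPos c m ((1 : Fin 2), z))
      = (Finset.univ.filter fun a : Fin α => m ≤ (a : ℕ)).sym2 \
        (Finset.univ.filter fun a : Fin α => m ≤ (a : ℕ) ∧ (a : ℕ) < c - 1).sym2 := by
    ext z
    induction z with
    | _ a b =>
      simp [IsRandomPos]
      omega
  have hcard : ∀ x y : ℕ, y ≤ α →
      (Finset.univ.filter fun a : Fin α => x ≤ (a : ℕ) ∧ (a : ℕ) < y).card = y - x := by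
    intro x y hy
    rw [← Nat.card_Ico, ← Finset.card_map Fin.valEmbedding]
    congr 1
    ext a
    simp only [Finset.mem_map, Finset.mem_filter, Finset.mem_univ, true_and, Fin.valEmbedding_apply,
      Finset.mem_Ico]
    exact ⟨fun ⟨b, hb, e⟩ => e ▸ hb, fun h => ⟨⟨a, by omega⟩, h, rfl⟩⟩
  have hcard' : ∀ x : ℕ, (Finset.univ.filter fun a : Fin α => x ≤ (a : ℕ)).card = α - x := by
    intro x
    simpa using hcard x α le_rfl
  rw [Nat.card_eq_fintype_card, Fintype.card_subtype, Finset.card_filter, Fintype.sum_prod_type,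
    Fin.sum_univ_two, ← Finset.card_filter, ← Finset.card_filter, h0, h1,
    Finset.card_sdiff_of_subset (Finset.sym2_mono fun a => by simp +contextual),
    Finset.card_sym2, Finset.card_sym2, Finset.card_sym2, hcard', hcard', hcard _ _ (by omega)]
  obtain ⟨p, rfl⟩ : ∃ p, c = m + 1 + p := ⟨c - (m + 1), by omega⟩
  obtain ⟨t, rfl⟩ : ∃ t, α = m + 1 + p + t := ⟨α - (m + 1 + p), by omega⟩
  have e1 : m + 1 + p + t - (m + 1 + p) + 1 = t + 1 := by omega
  have e2 : m + 1 + p + t - m + 1 = (p + t + 1) + 1 := by omega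
  have e3 : m + 1 + p - 1 - m + 1 = p + 1 := by omega
  have e4 : m + 1 + p + t - m = p + t + 1 := by omega
  have e5 : m + 1 + p + t + 1 - (m + 1 + p) = t + 1 := by omega
  rw [e1, e2, e3, e4, e5]
  have key : ∀ x : ℕ, ((x + 1).choose 2 : ℚ) = (x + 1) * x / 2 := fun x => by
    rw [Nat.cast_choose_two]; push_cast; ring
  have hle : (p + 1).choose 2 ≤ (p + t + 1 + 1).choose 2 := Nat.choose_le_choose 2 (by omega)
  have : (((t + 1).choose 2 + ((p + t + 1 + 1).choose 2 - (p + 1).choose 2) : ℕ) : ℚ)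
      = (((p + t + 1) * (t + 1) : ℕ) : ℚ) := by
    rw [Nat.cast_add, Nat.cast_sub hle, key, key, key]
    push_cast
    ring
  exact_mod_cast this

/-- This makes shortening the level `{i, 0}` case of the results on random positions. -/
lemma isForcedPos_iff {i : ℕ} (p : Pos α) : IsForcedPos i p ↔ IsRandomPos i 0 p := by
  simp [IsForcedPos, IsRandomPos]

lemma IsForcedPos.isRandomPos {i ℓ m : ℕ} {p : Pos α} (h : IsForcedPos i p) :
    IsRandomPos (ℓ + i) m p := by
  rcases h with ⟨h, a, ha, hlt⟩ | ⟨h, hall⟩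
  · exact Or.inl ⟨h, a, ha, by omega⟩
  · exact Or.inr ⟨h, Or.inl fun a ha => by have := hall a ha; omega⟩

lemma card_pos : Nat.card (Pos α) = α * (α + 1) := by
  rw [Nat.card_eq_fintype_card, Fintype.card_prod, Fintype.card_fin, Sym2.card, Fintype.card_fin,
    Nat.choose_two_right, Nat.add_sub_cancel, mul_comm 2, Nat.div_mul_cancel, mul_comm]
  exact (Nat.even_mul_pred_self (α + 1)).two_dvd

/-- Forced positions are random in the longer code, so the non-forced ones split into message and
remaining random positions. -/
lemma card_randPos {i ℓ m : ℕ} (hi : 1 ≤ i) (hm : m ≤ ℓ) (h : ℓ + i ≤ α) :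
    Nat.card (RandPos α i ℓ m) + (α - m) * (α + 1 - (ℓ + i)) = α * (α + 1 - i) := by
  classical
  have h1 := card_notRandom (α := α) (c := ℓ + i) (m := m) (by omega) h
  have h2 := card_notRandom (α := α) (c := i) (m := 0) (by omega) (by omega)
  rw [Nat.sub_zero] at h2
  rw [← h1, ← h2, Nat.card_eq_fintype_card, Nat.card_eq_fintype_card, Nat.card_eq_fintype_card,
    Fintype.card_subtype, Fintype.card_subtype, Fintype.card_subtype,
    ← Finset.card_union_of_disjoint]
  · congr 1
    ext p
    have := IsForcedPos.isRandomPos (i := i) (ℓ := ℓ) (m := m) (p := p)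
    have := isForcedPos_iff (i := i) p
    simp only [Finset.mem_union, Finset.mem_filter, Finset.mem_univ, true_and]
    tauto
  · rw [Finset.disjoint_filter]
    tauto

end Counting

/-! ### Vandermonde encoding matrices -/

section Vandermonde

variable {F : Type*} [Field F] {N α : ℕ}

lemma anyRowsIndep_of_pow {r c : Type*} {A : Matrix r c F} {t : ℕ} (e : c ≃ Fin t) {x : r → F}
    (hx : Function.Injective x) (hA : ∀ a j, A a j = x a ^ (e j : ℕ)) : AnyRowsIndep A t := by
  intro s hs
  have σ : Fin t ≃ s := (s.equivFinOfCardEq hs).symm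
  have hdet : (Matrix.vandermonde fun y => x (σ y)).det ≠ 0 :=
    Matrix.det_vandermonde_ne_zero_iff.2
      (hx.comp (Subtype.val_injective.comp σ.injective))
  have hli := (Matrix.linearIndependent_rows_of_det_ne_zero hdet).map'
    (LinearEquiv.funCongrLeft F F e).toLinearMap (LinearEquiv.ker _)
  have hrows : (fun a : s => A a) ∘ σ = (LinearEquiv.funCongrLeft F F e).toLinearMap ∘
      (Matrix.vandermonde fun y => x (σ y)).row := by
    ext y j
    simp [hA, LinearEquiv.funCongrLeft, LinearMap.funLeft]
  rw [← linearIndependent_equiv σ, hrows]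
  exact hli

lemma vandermonde_isAdmissible {i ℓ m : ℕ} (hm : m ≤ ℓ) (h : ℓ + i ≤ α) {x : Fin N → F}
    (hx : Function.Injective fun j => x j ^ α) :
    IsAdmissible i ℓ m (vandermondePhi α x) (fun j => x j ^ α) := by
  have hinj : Function.Injective x := fun a b hab => hx (by simp [hab])
  refine ⟨anyRowsIndep_of_pow (Equiv.refl _) hinj fun a j => rfl, ?_, hx, fun c hc => ?_⟩
  · rw [two_mul]
    refine anyRowsIndep_of_pow finSumFinEquiv hinj fun a j => ?_
    rcases j with j | j
    · simp [encodingMatrix, vandermondePhi]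
    · simp [encodingMatrix, vandermondePhi, Matrix.diagonal_mul, pow_add, mul_comm]
  · have hcα : c ≤ α := by
      simp only [Set.mem_insert_iff, Set.mem_singleton_iff] at hc
      omega
    exact anyRowsIndep_of_pow
      { toFun := fun a => ⟨a.1, a.2⟩
        invFun := fun a => ⟨⟨a, by omega⟩, a.2⟩
        left_inv := fun a => rfl
        right_inv := fun a => rfl } hinj fun a j => rfl

end Vandermonde

/-! ### The square linear system, and repair -/

section Filling

variable {F : Type*} [Field F] {N α : ℕ}

/-- The map that sends a filling to the contents of the nodes in `R`, to the products
`φ_f S₂ φ_e` for `f ∈ B` and `e ∈ E`, and to the non-random symbols. -/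
def constraintMap (Φ : Matrix (Fin N) (Fin α) F) (lam : Fin N → F) (c m : ℕ)
    (R B E : Finset (Fin N)) : (Pos α → F) →ₗ[F]
      ((R × Fin α) ⊕ (B × E)) ⊕ {p : Pos α // ¬ IsRandomPos c m p} → F where
  toFun v := Sum.elim
    (Sum.elim (fun x => codeMatrix Φ lam v x.1 x.2) fun x => blockRow Φ v 1 x.1 ⬝ᵥ Φ x.2)
    fun p => v p
  map_add' v w := by
    ext ((x | x) | x)
    · simp [codeMatrix_row, blockRow_add]
      ring
    · simp [blockRow_add, add_dotProduct]
    · simp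
  map_smul' a v := by
    ext ((x | x) | x)
    · simp [codeMatrix_row, blockRow_smul]
      ring
    · simp [blockRow_smul]
    · simp

/-- For all values of the non-random symbols of level `{c, m}`, the random symbols can be chosen
such that `c` given nodes store zero and the `S₂` parts of `m` of these are orthogonal to the rows
in `E`. -/
lemma exists_filling {Φ : Matrix (Fin N) (Fin α) F} {lam : Fin N → F} {c m : ℕ}
    (hmc : m < c) (hcα : c ≤ α) (hΦ : AnyRowsIndep Φ α) (hlam : Function.Injective lam)
    (hlead : ∀ x ∈ ({m, c - 1, c} : Set ℕ), AnyRowsIndep (firstCols Φ x) x)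
    {R B E : Finset (Fin N)} (hR : R.card = c) (hBR : B ⊆ R) (hB : B.card = m)
    (hE : Disjoint R E) (hEc : E.card = α + 1 - c)
    (u : {p : Pos α // ¬ IsRandomPos c m p} → F) :
    ∃ v : Pos α → F, (∀ p, v p.1 = u p) ∧ (∀ a ∈ R, codeMatrix Φ lam v a = 0) ∧
      ∀ f ∈ B, ∀ e ∈ E, blockRow Φ v 1 f ⬝ᵥ Φ e = 0 := by
  classical
  have hinj : Function.Injective (constraintMap Φ lam c m R B E) := by
    rw [← LinearMap.ker_eq_bot, LinearMap.ker_eq_bot']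
    intro v hv
    exact eq_zero_of_supported hmc hcα hΦ hlam hlead hR hBR hB hE hEc
      (fun p hp => congrFun hv (Sum.inr ⟨p, hp⟩))
      (fun a ha => funext fun j => congrFun hv (Sum.inl (Sum.inl (⟨a, ha⟩, j))))
      (fun f hf e he => congrFun hv (Sum.inl (Sum.inr (⟨f, hf⟩, ⟨e, he⟩))))
  have hcard := card_notRandom hmc hcα
  have hpos := card_pos (α := α)
  rw [Nat.card_eq_fintype_card] at hcard hpos
  have hsurj : Function.Surjective (constraintMap Φ lam c m R B E) := by
    refine (LinearMap.injective_iff_surjective_of_finrank_eq_finrank ?_).1 hinj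
    rw [Module.finrank_fintype_fun_eq_card, Module.finrank_fintype_fun_eq_card, hpos,
      Fintype.card_sum, Fintype.card_sum, Fintype.card_prod, Fintype.card_prod, Fintype.card_coe,
      Fintype.card_coe, Fintype.card_coe, Fintype.card_fin, hR, hB, hEc, hcard]
    obtain ⟨y, hy⟩ : ∃ y, α + 1 = c + y := ⟨α + 1 - c, by omega⟩
    obtain ⟨z, hz⟩ : ∃ z, α = m + z := ⟨α - m, by omega⟩
    rw [hy, hz, Nat.add_sub_cancel_left, Nat.add_sub_cancel_left]
    ring
  obtain ⟨v, hv⟩ := hsurj (Sum.elim 0 u)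
  exact ⟨v, fun p => congrFun hv (Sum.inr p),
    fun a ha => funext fun j => congrFun hv (Sum.inl (Sum.inl (⟨a, ha⟩, j))),
    fun f hf e he => congrFun hv (Sum.inl (Sum.inr (⟨f, hf⟩, ⟨e, he⟩)))⟩

/-- By symmetry, each helper symbol is a linear functional `ψ_a` of the same `2α` unknowns, which
depend only on the failed node `f`. -/
lemma codeMatrix_dotProduct (Φ : Matrix (Fin N) (Fin α) F) (lam : Fin N → F) (v : Pos α → F)
    (a f : Fin N) : codeMatrix Φ lam v a ⬝ᵥ Φ f =
      encodingMatrix Φ lam a ⬝ᵥ Sum.elim (blockRow Φ v 0 f) (blockRow Φ v 1 f) := by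
  rw [codeMatrix_row, add_dotProduct, smul_dotProduct, blockRow_dotProduct_comm,
    blockRow_dotProduct_comm Φ v 1, dotProduct_comm, dotProduct_comm _ (Φ a)]
  simp [dotProduct, encodingMatrix, Matrix.diagonal_mul, Finset.mul_sum, mul_assoc]

/-- A node stores zero if `2α` nodes would pass zero for its repair. -/
lemma codeMatrix_eq_zero_of_repair {Φ : Matrix (Fin N) (Fin α) F} {lam : Fin N → F}
    (h : AnyRowsIndep (encodingMatrix Φ lam) (2 * α)) {s : Finset (Fin N)} (hs : s.card = 2 * α)
    {v : Pos α → F} {f : Fin N} (hzero : ∀ a ∈ s, codeMatrix Φ lam v a ⬝ᵥ Φ f = 0) :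
    codeMatrix Φ lam v f = 0 := by
  have hw := h.eq_zero_of_dotProduct (by simp [two_mul]) hs
    fun a ha => (codeMatrix_dotProduct Φ lam v a f).symm.trans (hzero a ha)
  ext j
  have h0 : blockRow Φ v 0 f j = 0 := congrFun hw (Sum.inl j)
  have h1 : blockRow Φ v 1 f j = 0 := congrFun hw (Sum.inr j)
  simp [codeMatrix_row, h0, h1]

end Filling

/-! ### The shortened code inside the longer one -/

section Shortening

variable {F : Type*} [Field F] {n α i ℓ m : ℕ}

/-- The removed nodes together with the nodes in `K`, as nodes of the longer code. -/
def withRemoved (i : ℕ) (K : Finset (Fin n)) : Finset (Fin (i + n)) :=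
  Finset.univ.map (Fin.castAddEmb n) ∪ K.map (Fin.natAddEmb i)

lemma forall_mem_withRemoved {K : Finset (Fin n)} {p : Fin (i + n) → Prop} :
    (∀ a ∈ withRemoved i K, p a) ↔
      (∀ j : Fin i, p (Fin.castAdd n j)) ∧ ∀ j ∈ K, p (Fin.natAdd i j) := by
  simp [withRemoved, or_imp, forall_and]

lemma card_withRemoved (K : Finset (Fin n)) : (withRemoved i K).card = i + K.card := by
  rw [withRemoved, Finset.card_union_of_disjoint, Finset.card_map, Finset.card_map,
    Finset.card_univ, Fintype.card_fin]
  simp only [Finset.disjoint_left, Finset.mem_map, Finset.mem_univ, true_and, not_exists, not_and]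
  rintro _ ⟨a, rfl⟩ b - h
  have := congrArg Fin.val h
  simp at this
  omega

lemma shortenedCodeMatrix_row (Φ : Matrix (Fin (i + n)) (Fin α) F) (lam : Fin (i + n) → F)
    (v : Pos α → F) (j : Fin n) :
    shortenedCodeMatrix Φ lam v j = codeMatrix Φ lam v (Fin.natAdd i j) := by
  rw [shortenedCodeMatrix, codeMatrix_row, codeMatrix_row]
  rfl

lemma shortenedCodeMatrix_sub (Φ : Matrix (Fin (i + n)) (Fin α) F) (lam : Fin (i + n) → F)
    (v w : Pos α → F) : shortenedCodeMatrix Φ lam (v - w) =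
      shortenedCodeMatrix Φ lam v - shortenedCodeMatrix Φ lam w := by
  funext j
  exact (shortenedCodeMatrix_row _ _ _ _).trans ((codeMatrix_row_sub _ _ _ _ _).trans
    (congrArg₂ _ (shortenedCodeMatrix_row _ _ _ _).symm (shortenedCodeMatrix_row _ _ _ _).symm))

lemma repairSymbol_sub (Φ C D : Matrix (Fin n) (Fin α) F) (f j : Fin n) :
    repairSymbol Φ (C - D) f j = repairSymbol Φ C f j - repairSymbol Φ D f j :=
  sub_dotProduct _ _ _

lemma repairSymbol_shortened (Φ : Matrix (Fin (i + n)) (Fin α) F) (lam : Fin (i + n) → F)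
    (v : Pos α → F) (f j : Fin n) :
    repairSymbol (lastRows Φ) (shortenedCodeMatrix Φ lam v) f j =
      codeMatrix Φ lam v (Fin.natAdd i j) ⬝ᵥ Φ (Fin.natAdd i f) := by
  rw [repairSymbol, shortenedCodeMatrix_row]
  rfl

lemma IsShortenedFilling.sub {Φ : Matrix (Fin (i + n)) (Fin α) F} {lam : Fin (i + n) → F}
    {u u' : MsgPos α i ℓ m → F} {r r' : RandPos α i ℓ m → F} {v v' : Pos α → F}
    (h : IsShortenedFilling Φ lam u r v) (h' : IsShortenedFilling Φ lam u' r' v') :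
    IsShortenedFilling Φ lam (u - u') (r - r') (v - v') where
  message p := by simp [h.message, h'.message]
  random p := by simp [h.random, h'.random]
  zero j := by rw [codeMatrix_row_sub, h.zero, h'.zero, sub_zero]

lemma existsUnique_shortenedFilling {Φ : Matrix (Fin (i + n)) (Fin α) F} {lam : Fin (i + n) → F}
    (hi : 1 ≤ i) (hα : i ≤ α) (hn : α < i + n) (h : IsAdmissible i ℓ m Φ lam)
    (u : MsgPos α i ℓ m → F) (r : RandPos α i ℓ m → F) :
    ∃! v, IsShortenedFilling Φ lam u r v := by
  classical
  have hR : (withRemoved i (∅ : Finset (Fin n))).card = i := by simp [card_withRemoved]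
  -- With `B = ∅` the set `E` imposes no condition; it only fits the general statement.
  obtain ⟨E, hEs, hEc⟩ := Finset.exists_subset_card_eq (n := α + 1 - i)
    (s := (withRemoved i (∅ : Finset (Fin n)))ᶜ)
    (by rw [Finset.card_compl, hR, Fintype.card_fin]; omega)
  have hE : Disjoint (withRemoved i (∅ : Finset (Fin n))) E :=
    (Finset.subset_compl_iff_disjoint_left.1 hEs)
  have hlead : ∀ x ∈ ({0, i - 1, i} : Set ℕ), AnyRowsIndep (firstCols Φ x) x := by
    rintro x (rfl | rfl | rfl)
    · intro s hs
      obtain rfl := Finset.card_eq_zero.1 hs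
      exact linearIndependent_empty_type
    · exact h.leading_indep _ (by simp)
    · exact h.leading_indep _ (by simp)
  obtain ⟨v, hv, hz, -⟩ := exists_filling (lam := lam) (by omega) hα h.phi_indep h.lam_injective
    hlead hR (Finset.empty_subset _) Finset.card_empty hE hEc
    (fun p => if hp : IsRandomPos (ℓ + i) m p.1
      then r ⟨p.1, hp, fun hf => p.2 ((isForcedPos_iff _).1 hf)⟩ else u ⟨p.1, hp⟩)
  have hfill : IsShortenedFilling Φ lam u r v := by
    refine ⟨fun p => ?_, fun p => ?_, (forall_mem_withRemoved.1 hz).1⟩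
    · refine (hv ⟨p.1, fun hf => p.2 ((isForcedPos_iff _).2 hf).isRandomPos⟩).trans ?_
      rw [dif_neg p.2]
    · refine (hv ⟨p.1, fun hf => p.2.2 ((isForcedPos_iff _).2 hf)⟩).trans ?_
      rw [dif_pos p.2.1]
  refine ⟨v, hfill, fun w hw => sub_eq_zero.1 ?_⟩
  have hs := hw.sub hfill
  refine eq_zero_of_supported (lam := lam) (by omega) hα h.phi_indep h.lam_injective hlead hR
    (Finset.empty_subset _) Finset.card_empty hE hEc (fun p hp => ?_)
    (forall_mem_withRemoved.2 ⟨hs.zero, by simp⟩) (by simp)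
  by_cases hrand : IsRandomPos (ℓ + i) m p
  · simpa using hs.random ⟨p, hrand, fun hf => hp ((isForcedPos_iff _).1 hf)⟩
  · simpa using hs.message ⟨p, hrand⟩

/-- The contents of `α + 1 - i` nodes of the shortened code determine the filling. -/
lemma IsShortenedFilling.eq_zero_of_contents {Φ : Matrix (Fin (i + n)) (Fin α) F}
    {lam : Fin (i + n) → F} (h : IsAdmissible i ℓ m Φ lam) {u : MsgPos α i ℓ m → F}
    {r : RandPos α i ℓ m → F} {v : Pos α → F} (hv : IsShortenedFilling Φ lam u r v)
    {K : Finset (Fin n)} (hK : i + K.card = α + 1)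
    (hzero : ∀ j ∈ K, shortenedCodeMatrix Φ lam v j = 0) : v = 0 := by
  have hz : ∀ a ∈ withRemoved i K, codeMatrix Φ lam v a = 0 :=
    forall_mem_withRemoved.2 ⟨hv.zero, fun j hj => by
      rw [← shortenedCodeMatrix_row, hzero j hj]⟩
  funext ⟨t, z⟩
  exact block_eq_zero h.phi_indep ((card_withRemoved K).trans hK) (fun a ha b hb hab =>
    blockRow_dotProduct_eq_zero h.lam_injective hab (hz a ha) (hz b hb) t) z

/-- For every message there are random symbols for which the eavesdropper sees only zeros. -/
lemma exists_filling_view_eq_zero {Φ : Matrix (Fin (i + n)) (Fin α) F} {lam : Fin (i + n) → F}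
    (hi : 1 ≤ i) (hm : m ≤ ℓ) (hα : ℓ + i ≤ α) (hn : α < i + n) (h : IsAdmissible i ℓ m Φ lam)
    {A B : Finset (Fin n)} (hA : A.card ≤ ℓ) (hBA : B ⊆ A) (hB : B.card ≤ m)
    {T : Finset (Fin n × Finset (Fin n))} (hT : ∀ t ∈ T, t.1 ∈ B) (u : MsgPos α i ℓ m → F) :
    ∃ r v, IsShortenedFilling Φ lam u r v ∧
      view (lastRows Φ) A T (shortenedCodeMatrix Φ lam v) = 0 := by
  classical
  -- Enlarging `A` and `B` to exactly `ℓ` and `m` nodes only strengthens the eavesdropper.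
  obtain ⟨A', hAA', hA'⟩ := Finset.exists_superset_card_eq hA (by simp; omega)
  obtain ⟨B', hBB', hBA', hB'⟩ :=
    Finset.exists_subsuperset_card_eq (hBA.trans hAA') hB (hm.trans hA'.ge)
  have hR : (withRemoved i A').card = ℓ + i := by rw [card_withRemoved, hA', add_comm]
  obtain ⟨E, hEs, hEc⟩ := Finset.exists_subset_card_eq (n := α + 1 - (ℓ + i))
    (s := (withRemoved i A')ᶜ) (by rw [Finset.card_compl, hR, Fintype.card_fin]; omega)
  have hE : Disjoint (withRemoved i A') E := (Finset.subset_compl_iff_disjoint_left.1 hEs)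
  have hlead : ∀ x ∈ ({m, ℓ + i - 1, ℓ + i} : Set ℕ), AnyRowsIndep (firstCols Φ x) x := by
    rintro x (rfl | rfl | rfl) <;> exact h.leading_indep _ (by simp)
  have hsub : B'.map (Fin.natAddEmb i) ⊆ withRemoved i A' :=
    (Finset.map_subset_map.2 hBA').trans Finset.subset_union_right
  obtain ⟨v, hv, hz, ho⟩ := exists_filling (lam := lam) (by omega) hα h.phi_indep h.lam_injective
    hlead hR hsub (by simpa using hB') hE hEc u
  have hz' := forall_mem_withRemoved.1 hz
  refine ⟨fun p => v p, v, ⟨hv, fun p => rfl, hz'.1⟩, Prod.ext ?_ ?_⟩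
  · funext a
    exact (shortenedCodeMatrix_row _ _ _ _).trans (hz'.2 _ (hAA' a.2))
  · funext t j
    have hf : Fin.natAdd i t.1.1 ∈ B'.map (Fin.natAddEmb i) :=
      Finset.mem_map_of_mem (Fin.natAddEmb i) (hBB' (hT _ t.2))
    -- Both block rows of `f` vanish, so every possible helper passes zero; `E` need not be related
    -- to the actual helpers.
    have hrow := blockRow_eq_zero_of_orthogonal h.phi_indep h.lam_injective hE (by omega) hz
      (hsub hf) (ho _ hf)
    refine (repairSymbol_shortened _ _ _ _ _).trans ?_
    rw [codeMatrix_dotProduct, hrow, hrow]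
    simp [dotProduct]

lemma view_sub (Φ : Matrix (Fin n) (Fin α) F) (A : Finset (Fin n))
    (T : Finset (Fin n × Finset (Fin n))) (C D : Matrix (Fin n) (Fin α) F) :
    view Φ A T (C - D) = view Φ A T C - view Φ A T D :=
  Prod.ext rfl (funext fun _ => funext fun _ => repairSymbol_sub _ _ _ _ _)

end Shortening

/-! ### Independence and mutual information -/

section Information

lemma map_sub_right_uniformOn {G : Type*} [AddGroup G] [Finite G] [MeasurableSpace G]
    [MeasurableSingletonClass G] (g : G) :
    (ProbabilityTheory.uniformOn (Set.univ : Set G)).map (fun x => x - g) =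
      ProbabilityTheory.uniformOn Set.univ := by
  have := Fintype.ofFinite G
  ext s hs
  rw [Measure.map_apply (measurable_of_finite _) hs, ProbabilityTheory.uniformOn_univ,
    ProbabilityTheory.uniformOn_univ]
  have : (fun x => x - g) ⁻¹' s = (fun x => x + g) '' s := by
    ext x
    simp [sub_eq_add_neg]
  rw [this, Measure.count_injective_image (add_left_injective g)]

/-- If the conditional law of `g u` does not depend on `u`, then it carries no information
about `u`. -/
lemma mutualInfo_fst_eq_zero {U R Y : Type*} [MeasurableSpace U] [MeasurableSpace R]
    [MeasurableSpace Y] {ν : Measure U} {μ : Measure R} [IsProbabilityMeasure ν]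
    [IsProbabilityMeasure μ] {g : U → R → Y} (hg : Measurable (Function.uncurry g))
    {κ : Measure Y} (hκ : ∀ u, μ.map (g u) = κ) :
    mutualInfo (ν.prod μ) (fun ω => ω.1) (fun ω => g ω.1 ω.2) = 0 := by
  obtain ⟨u₀⟩ : Nonempty U := nonempty_of_isProbabilityMeasure ν
  have : IsProbabilityMeasure κ := by
    rw [← hκ u₀]
    exact Measure.isProbabilityMeasure_map (hg.comp measurable_prodMk_left).aemeasurable
  -- The joint law of message and observation is the product `ν ⊗ κ`.
  have hjoint := (MeasurePreserving.id ν).skew_product hg (Filter.Eventually.of_forall hκ)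
  have hfst : (ν.prod μ).map (fun ω => ω.1) = ν := Measure.fst_prod
  have hsnd : (ν.prod μ).map (fun ω => g ω.1 ω.2) = κ := by
    have := congrArg (Measure.map Prod.snd) hjoint.map_eq
    rw [Measure.map_map measurable_snd hjoint.measurable] at this
    exact this.trans Measure.snd_prod
  rw [mutualInfo, hfst, hsnd]
  exact (congrArg₂ _ hjoint.map_eq rfl).trans (InformationTheory.klDiv_self _)

end Information

end SecureMSR

/-! ### Assembly of the theorem -/

theorem mainTheorem8 {F : Type*} [Field F] [Finite F] [MeasurableSpace F]
    [MeasurableSingletonClass F] (n k i ℓ m : ℕ) (hi : 1 ≤ i) (hℓ : ℓ < k) (hm : m ≤ ℓ)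
    (hn : 2 * k - 2 + i < n) :
    -- numbers of message symbols, of remaining random symbols and of deterministic symbols
    Nat.card (MsgPos (k - 1 + i) i ℓ m) = (k - ℓ) * (k - 1 + i - m) ∧
    Nat.card (RandPos (k - 1 + i) i ℓ m) = ℓ * (k - 1 + i) + (k - ℓ) * m ∧
    Nat.card (MsgPos (k - 1 + i) i ℓ m) + Nat.card (RandPos (k - 1 + i) i ℓ m)
      = k * (k - 1 + i) ∧
    Nat.card {p : Pos (k - 1 + i) // IsForcedPos i p} = i * (k - 1 + i) ∧
    (∀ p : Pos (k - 1 + i), IsForcedPos i p → IsRandomPos (ℓ + i) m p) ∧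
    -- the Vandermonde choice of the encoding matrix is admissible
    (∀ x : Fin (i + n) → F, (Function.Injective fun j => x j ^ (k - 1 + i)) →
      IsAdmissible i ℓ m (vandermondePhi (k - 1 + i) x) (fun j => x j ^ (k - 1 + i))) ∧
    -- the shortened code exists, is an `[n, k, d = 2k - 2 + i]` code and is secure
    ∀ (Φ : Matrix (Fin (i + n)) (Fin (k - 1 + i)) F) (lam : Fin (i + n) → F),
      IsAdmissible i ℓ m Φ lam →
      ∃ fill : (MsgPos (k - 1 + i) i ℓ m → F) → (RandPos (k - 1 + i) i ℓ m → F) →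
          (Pos (k - 1 + i) → F),
        (∀ u r v, IsShortenedFilling Φ lam u r v ↔ v = fill u r) ∧
        Reconstructs k (fun u r => shortenedCodeMatrix Φ lam (fill u r)) ∧
        Repairs (2 * k - 2 + i) (lastRows Φ) (fun u r => shortenedCodeMatrix Φ lam (fill u r)) ∧
        IsSecure ℓ m (2 * k - 2 + i) (lastRows Φ)
          (fun u r => shortenedCodeMatrix Φ lam (fill u r)) := by
  obtain ⟨α, hα⟩ : ∃ α, k - 1 + i = α := ⟨_, rfl⟩
  rw [hα]
  have hki : α + 1 - i = k := by omega
  have hkℓ : α + 1 - (ℓ + i) = k - ℓ := by omega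
  have hmsg : Nat.card (MsgPos α i ℓ m) = (k - ℓ) * (α - m) := by
    rw [card_notRandom (by omega) (by omega), hkℓ, mul_comm]
  have hrand := card_randPos (α := α) hi hm (by omega)
  rw [hki, hkℓ, mul_comm (α - m), mul_comm α] at hrand
  refine ⟨hmsg, ?_, by rw [hmsg, add_comm, hrand], ?_, fun p hp => hp.isRandomPos,
    fun x hx => vandermonde_isAdmissible hm (by omega) hx, fun Φ lam h => ?_⟩
  · obtain ⟨y, rfl⟩ : ∃ y, k = ℓ + y := ⟨k - ℓ, by omega⟩
    obtain ⟨z, hz⟩ : ∃ z, α = m + z := ⟨α - m, by omega⟩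
    rw [hz, Nat.add_sub_cancel_left, Nat.add_sub_cancel_left] at hrand
    rw [hz, Nat.add_sub_cancel_left]
    linarith
  · classical
    have h1 := card_notRandom (α := α) (c := i) (m := 0) (by omega) (by omega)
    have h2 := card_pos (α := α)
    rw [Nat.card_eq_fintype_card] at h1 h2 ⊢
    have h3 := Fintype.card_subtype_compl fun p : Pos α => IsRandomPos i 0 p
    have h4 := Fintype.card_subtype_le fun p : Pos α => IsRandomPos i 0 p
    simp only [isForcedPos_iff]
    rw [h1, h2] at h3
    rw [h2] at h4
    obtain ⟨y, hy⟩ : ∃ y, α + 1 = i + y := ⟨α + 1 - i, by omega⟩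
    rw [hy, Nat.sub_zero, Nat.add_sub_cancel_left] at h3
    rw [hy] at h4
    have : α * (i + y) = i * α + α * y := by ring
    omega
  choose fill hfill huniq using
    existsUnique_shortenedFilling (ℓ := ℓ) (m := m) hi (by omega) (by omega) h
  -- Uniqueness of the filling makes it additive.
  have hsub : ∀ u r u' r', fill u r - fill u' r' = fill (u - u') (r - r') :=
    fun u r u' r' => huniq _ _ _ ((hfill u r).sub (hfill u' r'))
  refine ⟨fill, fun u r v => ⟨huniq u r v, fun e => e ▸ hfill u r⟩, ?_, ?_, ?_⟩
  · intro K hK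
    have hfac : Function.FactorsThrough (fun x : (MsgPos α i ℓ m → F) × (RandPos α i ℓ m → F) => x.1)
        (fun x => fun j : K => shortenedCodeMatrix Φ lam (fill x.1 x.2) j) := by
      rintro ⟨u, r⟩ ⟨u', r'⟩ hx
      have hs := (hfill u r).sub (hfill u' r')
      have h0 := hs.eq_zero_of_contents h (K := K) (by omega) fun j hj => by
        rw [shortenedCodeMatrix_sub]
        exact sub_eq_zero.2 (congrFun hx ⟨j, hj⟩)
      funext p
      have := hs.message p
      rw [h0] at this
      exact (sub_eq_zero.1 this.symm)
    -- The default `0` is taken only on data that no codeword produces.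
    exact ⟨Function.extend _ _ 0, fun u r => hfac.extend_apply 0 (u, r)⟩
  · intro f H hf hH
    have hfac : Function.FactorsThrough
        (fun x : (MsgPos α i ℓ m → F) × (RandPos α i ℓ m → F) =>
          shortenedCodeMatrix Φ lam (fill x.1 x.2) f)
        (fun x => fun j : H =>
          repairSymbol (lastRows Φ) (shortenedCodeMatrix Φ lam (fill x.1 x.2)) f j) := by
      rintro ⟨u, r⟩ ⟨u', r'⟩ hx
      have hs := (hfill u r).sub (hfill u' r')
      have h0 := codeMatrix_eq_zero_of_repair h.psi_indep (s := withRemoved i H)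
        (v := fill u r - fill u' r') (f := Fin.natAdd i f)
        (by rw [card_withRemoved, hH]; omega)
        (forall_mem_withRemoved.2 ⟨fun j => by rw [hs.zero, zero_dotProduct], fun j hj => by
          rw [← repairSymbol_shortened, shortenedCodeMatrix_sub, repairSymbol_sub]
          exact sub_eq_zero.2 (congrFun hx ⟨j, hj⟩)⟩)
      rw [← shortenedCodeMatrix_row, shortenedCodeMatrix_sub] at h0
      exact sub_eq_zero.1 h0
    exact ⟨Function.extend _ _ 0, fun u r => hfac.extend_apply 0 (u, r)⟩
  · intro A B T hA hBA hB hT ν hν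
    choose r₀ v₀ hv₀ hview using exists_filling_view_eq_zero hi hm (by omega) (by omega) h hA hBA hB
      (fun t ht => (hT t ht).1)
    -- Subtracting the filling `v₀ u`, whose view is zero, removes the message and translates the
    -- random symbols by `r₀ u`.
    have hshift : ∀ u r, view (lastRows Φ) A T (shortenedCodeMatrix Φ lam (fill u r)) =
        view (lastRows Φ) A T (shortenedCodeMatrix Φ lam (fill 0 (r - r₀ u))) := by
      intro u r
      rw [← sub_self u, ← hsub, shortenedCodeMatrix_sub, view_sub, ← huniq _ _ _ (hv₀ u), hview,
        sub_zero]
    have : IsProbabilityMeasure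
        (ProbabilityTheory.uniformOn (Set.univ : Set (RandPos α i ℓ m → F))) :=
      ProbabilityTheory.isProbabilityMeasure_uniformOn Set.finite_univ Set.univ_nonempty
    refine mutualInfo_fst_eq_zero
      (g := fun u r => view (lastRows Φ) A T (shortenedCodeMatrix Φ lam (fill u r)))
      (measurable_of_finite _)
      (κ := (ProbabilityTheory.uniformOn Set.univ).map fun r =>
        view (lastRows Φ) A T (shortenedCodeMatrix Φ lam (fill 0 r))) fun u => ?_
    simp only [hshift u]
    conv_rhs => rw [← map_sub_right_uniformOn (r₀ u)]
    rw [Measure.map_map (measurable_of_finite _) (measurable_of_finite _)]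
    rfl
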